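/- Let $H$ be a finite-dimensional complex Hilbert space, let $M\ge 1$, let $\tau_1,\dots,\tau_M$ be density operators on $H$ (self-adjoint, positive semidefinite, unit trace), and let $p_1,\dots,p_M\ge 0$ with $\sum_{i=1}^M p_i=1$. For a positive operator-valued measure $\mathcal P=\{\Pi_1,\dots,\Pi_M\}$ (positive semidefinite operators on $H$ with $\sum_{i}\Pi_i=\mathbb 1$) let $\epsilon(\mathcal P)=1-\sum_{i=1}^M p_i\operatorname{tr}(\tau_i\Pi_i)$ be its average error probability, and let $\epsilon^\star=\min_{\mathcal P}\epsilon(\mathcal P)$ be the minimum average error probability (the minimum is attained). For a self-adjoint operator $A$ with distinct eigenvalues $\lambda_j$ and orthogonal projections $E_j$ onto the corresponding eigenspaces, write $\{A\le 0\}=\sum_{j:\lambda_j\le 0}E_j$. Then $$\epsilon^\star=\max_{\mu_0,\;t\ge 0}\left\{\sum_{i=1}^M p_i\operatorname{tr}\bigl(\tau_i\{p_i\tau_i-t\mu_0\le 0\}\bigr)-t\right\},$$ where the maximum, which is attained, is over all density operators $\mu_0$ on $H$ and all real $t\ge 0$. -/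

import Mathlib

open scoped BigOperators

noncomputable section

namespace QuantumHT

variable {H : Type*} [NormedAddCommGroup H] [InnerProductSpace ℂ H] [FiniteDimensional ℂ H]

/-- The trace of an operator on the finite-dimensional Hilbert space `H`. -/
def tr (A : H →L[ℂ] H) : ℂ := LinearMap.trace ℂ H (A : H →ₗ[ℂ] H)

/-- A density operator: self-adjoint, positive semidefinite (`IsPositive` contains both),
with unit trace. -/
structure IsDensityOperator (ρ : H →L[ℂ] H) : Prop where
  isPositive : ρ.IsPositive
  tr_eq_one : tr ρ = 1

/-- A positive operator-valued measure with `M` outcomes. -/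
structure IsPOVM {M : ℕ} (P : Fin M → H →L[ℂ] H) : Prop where
  isPositive : ∀ i, (P i).IsPositive
  sum_eq_one : ∑ i, P i = 1

open Classical in
/-- The projector `{A ≤ 0} = ∑_{i : λᵢ ≤ 0} Eᵢ` of a self-adjoint operator `A`, where `λᵢ` runs over
the (distinct) eigenvalues of `A` and `Eᵢ` is the orthogonal projection onto the eigenspace of `λᵢ`.
The eigenvalues of a self-adjoint operator are real, so `λᵢ ≤ 0` is read on the real part. -/
def projNonpos (A : H →L[ℂ] H) : H →L[ℂ] H :=
  ∑ l : Module.End.Eigenvalues (A : Module.End ℂ H),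
    if ((l : ℂ)).re ≤ 0 then
      (Module.End.eigenspace (A : Module.End ℂ H) (l : ℂ)).starProjection
    else 0

/-- The average error probability `1 - ∑ᵢ pᵢ tr (τᵢ Pᵢ)` of the test `P`. The trace of a product of
two self-adjoint operators is real. -/
def errorProb {M : ℕ} (p : Fin M → ℝ) (τ : Fin M → H →L[ℂ] H) (P : Fin M → H →L[ℂ] H) : ℝ :=
  1 - ∑ i, p i * (tr (τ i * P i)).re

/-- The average error probabilities of all `M`-ary tests. -/
def achievableErrors {M : ℕ} (p : Fin M → ℝ) (τ : Fin M → H →L[ℂ] H) : Set ℝ :=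
  {e | ∃ P : Fin M → H →L[ℂ] H, IsPOVM P ∧ e = errorProb p τ P}

/-- The minimum average error probability over all `M`-ary tests. -/
def minErrorProb {M : ℕ} (p : Fin M → ℝ) (τ : Fin M → H →L[ℂ] H) : ℝ :=
  sInf (achievableErrors p τ)

/-- The information-spectrum expression `∑ᵢ pᵢ tr (τᵢ {pᵢ τᵢ - t μ₀ ≤ 0}) - t`. -/
def spectrumObjective {M : ℕ} (p : Fin M → ℝ) (τ : Fin M → H →L[ℂ] H)
    (μ₀ : H →L[ℂ] H) (t : ℝ) : ℝ :=
  ∑ i, p i * (tr (τ i * projNonpos ((p i : ℂ) • τ i - (t : ℂ) • μ₀))).re - t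

end QuantumHT

end

/-! The proof is semidefinite duality. Upper bound on the objective: put `Aᵢ = pᵢ τᵢ - t μ₀`. Among
`0 ≤ B ≤ 1`, `{Aᵢ > 0}` maximises `tr (Aᵢ B)` (`re_tr_mul_le`); taking `B = Pᵢ` and summing over
`i`, with `∑ tr (μ₀ Pᵢ) = 1`, gives `spectrumObjective_le_errorProb`. Attainment: compactness yields
an optimal test `P`. Its Lagrange operator `Y`, symmetrised so as to be self-adjoint before
optimality is used, has trace `1 - ε⋆` and dominates every `pⱼ τⱼ`
(`isPositive_lagrangeOperator_sub`). With `t = tr Y` and `μ₀ = Y / t`, every `Aᵢ ≤ 0`, so all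
projectors are `1` and the objective is `1 - t = ε⋆`. -/

namespace QuantumHT

open InnerProductSpace ContinuousLinearMap

/-! ### Trace of products of positive operators -/

section Trace

variable {H : Type*} [NormedAddCommGroup H] [InnerProductSpace ℂ H]

lemma tr_add (A B : H →L[ℂ] H) : tr (A + B) = tr A + tr B := by simp [tr]

lemma tr_sub (A B : H →L[ℂ] H) : tr (A - B) = tr A - tr B := by simp [tr]

lemma tr_smul (c : ℂ) (A : H →L[ℂ] H) : tr (c • A) = c * tr A := by simp [tr]

lemma tr_sum {ι : Type*} (s : Finset ι) (A : ι → H →L[ℂ] H) :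
    tr (∑ i ∈ s, A i) = ∑ i ∈ s, tr (A i) := by simp [tr]

lemma tr_mul_comm (A B : H →L[ℂ] H) : tr (A * B) = tr (B * A) := by
  simpa [tr] using LinearMap.trace_mul_comm ℂ (A : H →ₗ[ℂ] H) (B : H →ₗ[ℂ] H)

variable [FiniteDimensional ℂ H]

lemma tr_mul_rankOne (A : H →L[ℂ] H) (x : H) : tr (A * rankOne ℂ x x) = inner ℂ x (A x) := by
  rw [mul_def, comp_rankOne]
  exact trace_rankOne _ _

lemma IsPositive.re_tr_mul_nonneg {A B : H →L[ℂ] H} (hA : A.IsPositive) (hB : B.IsPositive) :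
    0 ≤ (tr (A * B)).re := by
  obtain ⟨m, u, rfl⟩ := isPositive_iff_eq_sum_rankOne.mp hB
  rw [Finset.mul_sum, tr_sum, Complex.re_sum]
  refine Finset.sum_nonneg fun i _ => ?_
  rw [tr_mul_rankOne]
  exact hA.re_inner_nonneg_right (u i)

lemma IsPositive.re_tr_nonneg {A : H →L[ℂ] H} (hA : A.IsPositive) : 0 ≤ (tr A).re := by
  simpa using IsPositive.re_tr_mul_nonneg hA isPositive_one

lemma IsPositive.ofReal_re_tr {A : H →L[ℂ] H} (hA : A.IsPositive) : ((tr A).re : ℂ) = tr A := by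
  obtain ⟨m, u, rfl⟩ := isPositive_iff_eq_sum_rankOne.mp hA
  rw [tr_sum, Complex.re_sum, Complex.ofReal_sum]
  refine Finset.sum_congr rfl fun i _ => ?_
  have h : tr (rankOne ℂ (u i) (u i)) = ((‖u i‖ ^ 2 : ℝ) : ℂ) := by
    simpa using tr_mul_rankOne 1 (u i)
  rw [h, Complex.ofReal_re]

lemma continuous_tr : Continuous (tr : (H →L[ℂ] H) → ℂ) := by
  let f : (H →L[ℂ] H) →ₗ[ℂ] ℂ :=
    { toFun := tr, map_add' := tr_add, map_smul' := fun c A => tr_smul c A }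
  exact f.continuous_of_finiteDimensional

end Trace

/-! ### Spectral projectors and the Neyman-Pearson inequality -/

section Spectral

variable {H : Type*} [NormedAddCommGroup H] [InnerProductSpace ℂ H] [FiniteDimensional ℂ H]

lemma sum_starProjection_eigenspace {A : H →L[ℂ] H} (hA : (A : H →ₗ[ℂ] H).IsSymmetric) :
    ∑ l : Module.End.Eigenvalues (A : Module.End ℂ H),
      (Module.End.eigenspace (A : Module.End ℂ H) (l : ℂ)).starProjection = 1 := by
  ext x
  rw [sum_apply]
  refine hA.orthogonalFamily_eigenspaces'.sum_projection_of_mem_iSup x ?_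
  have h := hA.orthogonalComplement_iSup_eigenspaces_eq_bot'
  rw [Submodule.orthogonal_eq_bot_iff] at h
  exact h ▸ Submodule.mem_top

lemma mul_starProjection_eigenspace (A : H →L[ℂ] H) (l : ℂ) :
    A * (Module.End.eigenspace (A : Module.End ℂ H) l).starProjection =
      l • (Module.End.eigenspace (A : Module.End ℂ H) l).starProjection := by
  ext x
  exact Module.End.mem_eigenspace_iff.mp (Submodule.starProjection_apply_mem _ x)

omit [FiniteDimensional ℂ H] in
lemma ofReal_re_eigenvalue {A : H →L[ℂ] H} (hA : (A : H →ₗ[ℂ] H).IsSymmetric)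
    (l : Module.End.Eigenvalues (A : Module.End ℂ H)) : (((l : ℂ).re : ℝ) : ℂ) = l :=
  Complex.conj_eq_iff_re.mp (hA.conj_eigenvalue_eq_self l.2)

lemma isPositive_starProjection (U : Submodule ℂ H) : U.starProjection.IsPositive := by
  simpa [← mul_def, U.isIdempotentElem_starProjection.eq] using
    isPositive_one.conj_starProjection U

lemma isPositive_neg_mul_projNonpos {A : H →L[ℂ] H} (hA : (A : H →ₗ[ℂ] H).IsSymmetric) :
    (-(A * projNonpos A)).IsPositive := by
  rw [projNonpos, Finset.mul_sum, ← Finset.sum_neg_distrib]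
  refine isPositive_sum _ fun l _ => ?_
  split_ifs with hl
  · rw [mul_starProjection_eigenspace, ← neg_smul]
    refine (isPositive_starProjection _).smul_of_nonneg ?_
    rw [← ofReal_re_eigenvalue hA l]
    exact_mod_cast neg_nonneg.mpr hl
  · simp

lemma isPositive_mul_one_sub_projNonpos {A : H →L[ℂ] H} (hA : (A : H →ₗ[ℂ] H).IsSymmetric) :
    (A * (1 - projNonpos A)).IsPositive := by
  rw [projNonpos, ← sum_starProjection_eigenspace hA, ← Finset.sum_sub_distrib, Finset.mul_sum]
  refine isPositive_sum _ fun l _ => ?_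
  split_ifs with hl
  · simp
  · rw [sub_zero, mul_starProjection_eigenspace]
    refine (isPositive_starProjection _).smul_of_nonneg ?_
    rw [← ofReal_re_eigenvalue hA l]
    exact_mod_cast (not_le.mp hl).le

lemma isPositive_one_sub_projNonpos {A : H →L[ℂ] H} (hA : (A : H →ₗ[ℂ] H).IsSymmetric) :
    (1 - projNonpos A).IsPositive := by
  rw [projNonpos, ← sum_starProjection_eigenspace hA, ← Finset.sum_sub_distrib]
  refine isPositive_sum _ fun l _ => ?_
  split_ifs with hl
  · simp
  · simpa using isPositive_starProjection _

lemma projNonpos_eq_one {A : H →L[ℂ] H} (hA : (-A).IsPositive) : projNonpos A = 1 := by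
  have hA' : (A : H →ₗ[ℂ] H).IsSymmetric := by
    intro x y
    simpa using hA.isSymmetric x y
  rw [projNonpos, ← sum_starProjection_eigenspace hA']
  refine Finset.sum_congr rfl fun l _ => if_pos ?_
  obtain ⟨v, hv⟩ := Module.End.HasEigenvalue.exists_hasEigenvector l.2
  have hAv : A v = (l : ℂ) • v := hv.apply_eq_smul
  have h := hA.re_inner_nonneg_right v
  rw [neg_apply, hAv, ← ofReal_re_eigenvalue hA' l, inner_neg_right, inner_smul_right,
    inner_self_eq_norm_sq_to_K] at h
  have h2 : 0 < ‖v‖ ^ 2 := by have := norm_pos_iff.mpr hv.2; positivity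
  have h3 : 0 ≤ -((l : ℂ).re * ‖v‖ ^ 2) := by
    have e : -(((l : ℂ).re : ℂ) * ((‖v‖ : ℝ) : ℂ) ^ 2) = ((-((l : ℂ).re * ‖v‖ ^ 2) : ℝ) : ℂ) := by
      push_cast; ring
    have h' : 0 ≤ (-(((l : ℂ).re : ℂ) * ((‖v‖ : ℝ) : ℂ) ^ 2)).re := h
    rwa [e, Complex.ofReal_re] at h'
  by_contra hl
  nlinarith [mul_pos (not_le.mp hl) h2]

/-- Among the operators `0 ≤ B ≤ 1`, the projector `{A > 0}` maximises `tr (A B)`. -/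
lemma re_tr_mul_le {A B : H →L[ℂ] H} (hA : (A : H →ₗ[ℂ] H).IsSymmetric) (hB : B.IsPositive)
    (hB' : (1 - B).IsPositive) :
    (tr (A * B)).re ≤ (tr (A * (1 - projNonpos A))).re := by
  have h1 := IsPositive.re_tr_mul_nonneg (isPositive_neg_mul_projNonpos hA) hB
  have h2 := IsPositive.re_tr_mul_nonneg (isPositive_mul_one_sub_projNonpos hA) hB'
  -- With `A₊ = A {A > 0}` and `A₋ = -A {A ≤ 0}`, this reads `A B = A₊ - A₋ B - A₊ (1 - B)`.
  have e : A * B = A * (1 - projNonpos A) - (-(A * projNonpos A) * B)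
      - A * (1 - projNonpos A) * (1 - B) := by noncomm_ring
  rw [e, tr_sub, tr_sub, Complex.sub_re, Complex.sub_re]
  linarith

end Spectral

/-! ### Optimal tests, weak duality and strong duality -/

section POVM

variable {H : Type*} [NormedAddCommGroup H] [InnerProductSpace ℂ H] [FiniteDimensional ℂ H]
  {M : ℕ} {p : Fin M → ℝ} {τ P : Fin M → H →L[ℂ] H}

omit [FiniteDimensional ℂ H] in
lemma IsPOVM.isPositive_one_sub (hP : IsPOVM P) (i : Fin M) : (1 - P i).IsPositive := by
  rw [← hP.sum_eq_one, ← Finset.add_sum_erase _ _ (Finset.mem_univ i), add_sub_cancel_left]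
  exact isPositive_sum _ fun j _ => hP.isPositive j

omit [FiniteDimensional ℂ H] in
lemma isClosed_setOf_isPositive : IsClosed {A : H →L[ℂ] H | A.IsPositive} := by
  simp only [isPositive_iff_complex, Set.ofPred_forall, Set.ofPred_and]
  refine isClosed_iInter fun x => ?_
  have h : Continuous fun A : H →L[ℂ] H => inner ℂ (A x) x := by fun_prop
  exact (isClosed_eq (Complex.continuous_ofReal.comp (Complex.continuous_re.comp h)) h).inter
    (isClosed_le continuous_const (Complex.continuous_re.comp h))

lemma isCompact_setOf_isPOVM : IsCompact {P : Fin M → H →L[ℂ] H | IsPOVM P} := by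
  have : CompleteSpace H := FiniteDimensional.complete ℂ H
  have : ProperSpace (H →L[ℂ] H) := FiniteDimensional.proper ℂ _
  refine Metric.isCompact_of_isClosed_isBounded ?_ ?_
  · have h : {P : Fin M → H →L[ℂ] H | IsPOVM P} =
        (⋂ i, {P : Fin M → H →L[ℂ] H | (P i).IsPositive}) ∩ {P | ∑ i, P i = 1} := by
      ext P
      simp only [Set.mem_ofPred_eq, Set.mem_inter_iff, Set.mem_iInter]
      exact ⟨fun h => ⟨h.1, h.2⟩, fun h => ⟨h.1, h.2⟩⟩
    rw [h]
    exact (isClosed_iInter fun i => isClosed_setOf_isPositive.preimage (continuous_apply i)).inter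
      (isClosed_eq (f := fun P : Fin M → H →L[ℂ] H => ∑ i, P i)
        (continuous_finsetSum _ fun i _ => continuous_apply i) continuous_const)
  · refine (Metric.isBounded_closedBall (x := 0) (r := 1)).subset fun P hP => ?_
    rw [mem_closedBall_zero_iff, pi_norm_le_iff_of_nonneg zero_le_one]
    intro i
    refine (CStarAlgebra.norm_le_one_iff_of_nonneg (P i) ?_).mpr ?_
    · exact (nonneg_iff_isPositive _).mpr (hP.isPositive i)
    · exact (le_def _ _).mpr (hP.isPositive_one_sub i)

omit [FiniteDimensional ℂ H] in
lemma exists_isPOVM (hM : 0 < M) : ∃ P : Fin M → H →L[ℂ] H, IsPOVM P :=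
  ⟨Pi.single ⟨0, hM⟩ 1, fun i => by
    by_cases h : i = ⟨0, hM⟩
    · subst h; simp [isPositive_one]
    · simp [h, isPositive_zero], by simp⟩

lemma exists_isPOVM_forall_errorProb_le (hM : 0 < M) (p : Fin M → ℝ) (τ : Fin M → H →L[ℂ] H) :
    ∃ P, IsPOVM P ∧ ∀ Q, IsPOVM Q → errorProb p τ P ≤ errorProb p τ Q := by
  have hc : Continuous (errorProb p τ) := by
    unfold errorProb
    refine continuous_const.sub (continuous_finsetSum _ fun i _ => continuous_const.mul ?_)
    exact Complex.continuous_re.comp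
      (continuous_tr.comp (continuous_const.mul (continuous_apply i)))
  obtain ⟨P, hP, h⟩ := isCompact_setOf_isPOVM.exists_isMinOn (exists_isPOVM hM) hc.continuousOn
  exact ⟨P, hP, fun Q hQ => h hQ⟩

lemma spectrumObjective_le_errorProb (hp : ∀ i, 0 ≤ p i) (hp_sum : ∑ i, p i = 1)
    (hτ : ∀ i, IsDensityOperator (τ i)) {μ₀ : H →L[ℂ] H} (hμ₀ : IsDensityOperator μ₀) {t : ℝ}
    (ht : 0 ≤ t) (hP : IsPOVM P) : spectrumObjective p τ μ₀ t ≤ errorProb p τ P := by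
  have key (i : Fin M) : p i * (tr (τ i * projNonpos ((p i : ℂ) • τ i - (t : ℂ) • μ₀))).re ≤
      p i - p i * (tr (τ i * P i)).re + t * (tr (μ₀ * P i)).re := by
    set A := (p i : ℂ) • τ i - (t : ℂ) • μ₀ with hA_def
    have hA : (A : H →ₗ[ℂ] H).IsSymmetric :=
      ((hτ i).isPositive.smul_of_nonneg (by exact_mod_cast hp i)).isSymmetric.sub
        (hμ₀.isPositive.smul_of_nonneg (by exact_mod_cast ht)).isSymmetric
    have h1 := re_tr_mul_le hA (hP.isPositive i) (hP.isPositive_one_sub i)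
    have h2 := IsPositive.re_tr_mul_nonneg hμ₀.isPositive (isPositive_one_sub_projNonpos hA)
    have e (X : H →L[ℂ] H) :
        (tr (A * X)).re = p i * (tr (τ i * X)).re - t * (tr (μ₀ * X)).re := by
      rw [hA_def, sub_mul, smul_mul_assoc, smul_mul_assoc, tr_sub, tr_smul, tr_smul,
        Complex.sub_re, Complex.re_ofReal_mul, Complex.re_ofReal_mul]
    have e' : (tr (τ i * (1 - projNonpos A))).re = 1 - (tr (τ i * projNonpos A)).re := by
      rw [mul_sub, mul_one, tr_sub, (hτ i).tr_eq_one]; simp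
    rw [e, e, e'] at h1
    -- The term `t tr (μ₀ {A > 0}) ≥ 0` is discarded here.
    nlinarith [mul_nonneg ht h2]
  have hs := Finset.sum_le_sum fun i (_ : i ∈ Finset.univ) => key i
  have hμ : ∑ i, t * (tr (μ₀ * P i)).re = t := by
    rw [← Finset.mul_sum, ← Complex.re_sum, ← tr_sum, ← Finset.mul_sum, hP.sum_eq_one, mul_one,
      hμ₀.tr_eq_one]
    simp
  rw [Finset.sum_add_distrib, Finset.sum_sub_distrib, hp_sum, hμ] at hs
  unfold spectrumObjective errorProb
  linarith

/-- The symmetrised Lagrange operator `∑ᵢ pᵢ (τᵢ Pᵢ + Pᵢ τᵢ) / 2` of the test `P`. -/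
noncomputable def lagrangeOperator (p : Fin M → ℝ) (τ P : Fin M → H →L[ℂ] H) : H →L[ℂ] H :=
  ∑ i, ((p i / 2 : ℝ) : ℂ) • (τ i * P i + P i * τ i)

omit [FiniteDimensional ℂ H] in
lemma re_tr_lagrangeOperator (p : Fin M → ℝ) (τ P : Fin M → H →L[ℂ] H) :
    (tr (lagrangeOperator p τ P)).re = 1 - errorProb p τ P := by
  rw [lagrangeOperator, errorProb, tr_sum, Complex.re_sum, sub_sub_cancel]
  refine Finset.sum_congr rfl fun i _ => ?_
  rw [tr_smul, tr_add, tr_mul_comm (P i), Complex.re_ofReal_mul, Complex.add_re]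
  ring

omit [FiniteDimensional ℂ H] in
lemma isSymmetric_lagrangeOperator (hτ : ∀ i, IsDensityOperator (τ i)) (hP : IsPOVM P) :
    (lagrangeOperator p τ P : H →ₗ[ℂ] H).IsSymmetric := by
  intro x y
  simp only [lagrangeOperator, coe_coe, sum_apply, smul_apply, add_apply, mul_def, comp_apply, sum_inner,
    inner_sum, inner_smul_left, inner_smul_right, inner_add_left, inner_add_right,
    Complex.conj_ofReal]
  refine Finset.sum_congr rfl fun i _ => ?_
  rw [(hτ i).isPositive.inner_left_eq_inner_right, (hP.isPositive i).inner_left_eq_inner_right,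
    (hP.isPositive i).inner_left_eq_inner_right, (hτ i).isPositive.inner_left_eq_inner_right,
    add_comm]

/-- The right side is the first-order loss of success probability when each `P i` is replaced by `(1
- εR) P i (1 - εR)`, where `R = rankOne ℂ v v`. -/
lemma re_inner_lagrangeOperator (p : Fin M → ℝ) (τ P : Fin M → H →L[ℂ] H) (v : H) :
    2 * (inner ℂ v (lagrangeOperator p τ P v)).re =
      ∑ i, p i * ((tr (τ i * (rankOne ℂ v v * P i))).re + (tr (τ i * (P i * rankOne ℂ v v))).re) := by
  simp only [lagrangeOperator, sum_apply, inner_sum, Complex.re_sum, Finset.mul_sum]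
  refine Finset.sum_congr rfl fun i _ => ?_
  rw [← mul_assoc (τ i) (P i), tr_mul_rankOne, ← mul_assoc, tr_mul_comm, ← mul_assoc,
    tr_mul_rankOne, smul_apply, inner_smul_right, Complex.re_ofReal_mul, add_apply,
    inner_add_right, Complex.add_re]
  ring

/-- Conjugation preserves positivity. Since `R = rankOne ℂ v v` is a projection, `(1 - εR)² = 1 -
ε(2 - ε)R`; the missing `ε(2 - ε)R` is assigned to outcome `j`. -/
lemma isPOVM_perturb (hP : IsPOVM P) {v : H} (hv : ‖v‖ = 1) (j : Fin M) {ε : ℝ} (hε : 0 ≤ ε)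
    (hε' : ε ≤ 2) :
    IsPOVM fun i => (1 - (ε : ℂ) • rankOne ℂ v v) * P i * (1 - (ε : ℂ) • rankOne ℂ v v) +
      if i = j then ((ε * (2 - ε) : ℝ) : ℂ) • rankOne ℂ v v else 0 := by
  have : CompleteSpace H := FiniteDimensional.complete ℂ H
  constructor
  · intro i
    refine IsPositive.add ?_ ?_
    · have h := (hP.isPositive i).conj_adjoint (1 - (ε : ℂ) • rankOne ℂ v v)
      have e : adjoint (1 - (ε : ℂ) • rankOne ℂ v v : H →L[ℂ] H) =
          1 - (ε : ℂ) • rankOne ℂ v v := by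
        rw [map_sub, LinearIsometryEquiv.map_smulₛₗ, adjoint_rankOne, ← star_eq_adjoint, star_one]
        simp
      rw [e] at h
      exact h
    · split_ifs
      · refine (isPositive_rankOne_self v).smul_of_nonneg ?_
        exact_mod_cast mul_nonneg hε (sub_nonneg.mpr hε')
      · exact isPositive_zero
  · have hR : rankOne ℂ v v * rankOne ℂ v v = rankOne ℂ v v := isIdempotentElem_rankOne_self hv
    rw [Finset.sum_add_distrib, ← Finset.sum_mul, ← Finset.mul_sum, hP.sum_eq_one, mul_one,
      Finset.sum_ite_eq' Finset.univ j]
    simp only [Finset.mem_univ, if_true, sub_mul, mul_sub, one_mul, mul_one, smul_mul_assoc,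
      mul_smul_comm, hR]
    push_cast
    module

lemma nonneg_of_forall_mul_le {a c : ℝ} (h : ∀ ε : ℝ, 0 < ε → ε ≤ 1 → ε * c ≤ a) : 0 ≤ a := by
  refine le_of_forall_pos_sub_le fun δ hδ => ?_
  have := h (min 1 (δ / (|c| + 1))) (by positivity) (min_le_left _ _)
  have h2 : min 1 (δ / (|c| + 1)) * (|c| + 1) ≤ δ := by
    rw [← le_div_iff₀ (by positivity)]; exact min_le_right _ _
  have h3 : 0 < min 1 (δ / (|c| + 1)) := by positivity
  nlinarith [neg_abs_le c]

/-- The Holevo optimality condition along a unit vector `v`. -/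
lemma re_inner_le_lagrangeOperator (hP : IsPOVM P)
    (hmin : ∀ Q, IsPOVM Q → errorProb p τ P ≤ errorProb p τ Q) (j : Fin M) {v : H}
    (hv : ‖v‖ = 1) :
    p j * (inner ℂ v (τ j v)).re ≤ (inner ℂ v (lagrangeOperator p τ P v)).re := by
  set R : H →L[ℂ] H := rankOne ℂ v v with hR_def
  set s := p j * (inner ℂ v (τ j v)).re with hs_def
  set C := ∑ i, p i * (tr (τ i * (R * P i * R))).re
  -- Optimality gives `0 ≤ 2ε(⟨v, Y v⟩ - s) - ε²(C - s)`, with `Y` the Lagrange operator; this `c`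
  -- results from dividing by `2ε`, and then `ε → 0`.
  refine sub_nonneg.mp (nonneg_of_forall_mul_le (c := (C - s) / 2) fun ε h0 h1 => ?_)
  have h := hmin _ (isPOVM_perturb hP hv j h0.le (by linarith))
  have hterm (i : Fin M) : p i * (tr (τ i * ((1 - (ε : ℂ) • R) * P i * (1 - (ε : ℂ) • R) +
      if i = j then ((ε * (2 - ε) : ℝ) : ℂ) • R else 0))).re =
      p i * (tr (τ i * P i)).re
        - ε * (p i * ((tr (τ i * (R * P i))).re + (tr (τ i * (P i * R))).re))
        + ε ^ 2 * (p i * (tr (τ i * (R * P i * R))).re)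
        + if i = j then ε * (2 - ε) * s else 0 := by
    have e : τ i * ((1 - (ε : ℂ) • R) * P i * (1 - (ε : ℂ) • R)) =
        τ i * P i - (ε : ℂ) • (τ i * (R * P i)) - (ε : ℂ) • (τ i * (P i * R))
          + ((ε ^ 2 : ℝ) : ℂ) • (τ i * (R * P i * R)) := by
      simp only [sub_mul, mul_sub, one_mul, mul_one, smul_mul_assoc, mul_smul_comm]
      push_cast
      module
    rw [mul_add, e, tr_add, tr_add, tr_sub, tr_sub, tr_smul, tr_smul, tr_smul]
    simp only [Complex.add_re, Complex.sub_re, Complex.re_ofReal_mul]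
    split_ifs with hij
    · subst hij
      rw [mul_smul_comm, tr_smul, Complex.re_ofReal_mul, hR_def, tr_mul_rankOne, hs_def]
      ring
    · simp [tr]
      ring
  simp only [errorProb, ← hR_def, hterm] at h
  rw [Finset.sum_add_distrib, Finset.sum_add_distrib, Finset.sum_sub_distrib, ← Finset.mul_sum,
    ← Finset.mul_sum, ← re_inner_lagrangeOperator, Finset.sum_ite_eq' Finset.univ j] at h
  simp only [Finset.mem_univ, if_true] at h
  have h' : 0 ≤ ε * (2 * ((inner ℂ v (lagrangeOperator p τ P v)).re - s) - ε * (C - s)) := by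
    linarith
  have := nonneg_of_mul_nonneg_right h' h0
  linarith

lemma isPositive_lagrangeOperator_sub (hτ : ∀ i, IsDensityOperator (τ i)) (hP : IsPOVM P)
    (hmin : ∀ Q, IsPOVM Q → errorProb p τ P ≤ errorProb p τ Q) (j : Fin M) :
    (lagrangeOperator p τ P - (p j : ℂ) • τ j).IsPositive := by
  have hsymm : ((lagrangeOperator p τ P - (p j : ℂ) • τ j : H →L[ℂ] H) : H →ₗ[ℂ] H).IsSymmetric := by
    intro x y
    have h1 := isSymmetric_lagrangeOperator (p := p) hτ hP x y
    simp only [coe_coe] at h1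
    simp only [coe_coe, sub_apply, smul_apply, inner_sub_left, inner_sub_right, inner_smul_left,
      inner_smul_right, Complex.conj_ofReal, h1, (hτ j).isPositive.inner_left_eq_inner_right]
  refine isPositive_def.mpr ⟨hsymm, fun x => ?_⟩
  rw [reApplyInnerSelf_apply, hsymm.apply_clm]
  rcases eq_or_ne x 0 with rfl | hx
  · simp
  have hv : ‖((‖x‖⁻¹ : ℝ) : ℂ) • x‖ = 1 := by simp [norm_smul, hx]
  have h := re_inner_le_lagrangeOperator hP hmin j hv
  simp only [map_smul, inner_smul_left, inner_smul_right, Complex.conj_ofReal,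
    Complex.re_ofReal_mul] at h
  have hpos : 0 < ‖x‖⁻¹ * ‖x‖⁻¹ := by have := norm_pos_iff.mpr hx; positivity
  rw [sub_apply, inner_sub_right, smul_apply, inner_smul_right]
  change 0 ≤ (_ - _ : ℂ).re
  rw [Complex.sub_re, Complex.re_ofReal_mul]
  by_contra hneg
  nlinarith

/-- Strong duality: the Lagrange operator of an optimal test, normalised, attains the bound. -/
lemma exists_spectrumObjective_eq (hp : ∀ i, 0 ≤ p i) (hp_sum : ∑ i, p i = 1)
    (hτ : ∀ i, IsDensityOperator (τ i)) (hP : IsPOVM P)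
    (hmin : ∀ Q, IsPOVM Q → errorProb p τ P ≤ errorProb p τ Q) :
    ∃ (μ₀ : H →L[ℂ] H) (t : ℝ), IsDensityOperator μ₀ ∧ 0 ≤ t ∧
      errorProb p τ P = spectrumObjective p τ μ₀ t := by
  obtain ⟨j, hj⟩ : ∃ j, 0 < p j := by
    by_contra! h
    linarith [Finset.sum_nonpos fun i (_ : i ∈ Finset.univ) => h i]
  set Y := lagrangeOperator p τ P
  set t := (tr Y).re with ht_def
  have hsub := isPositive_lagrangeOperator_sub hτ hP hmin
  have hY : Y.IsPositive := by
    simpa [Y] using (hsub j).add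
      ((hτ j).isPositive.smul_of_nonneg (c := (p j : ℂ)) (by exact_mod_cast hp j))
  -- `Y ≥ pⱼ τⱼ` forces `tr Y ≥ pⱼ > 0`, so `Y` can be normalised.
  have ht : 0 < t := by
    have h := IsPositive.re_tr_nonneg (hsub j)
    rw [tr_sub, tr_smul, (hτ j).tr_eq_one, mul_one, Complex.sub_re, Complex.ofReal_re] at h
    linarith
  have htY : (t : ℂ) = tr Y := IsPositive.ofReal_re_tr hY
  have ht0 : (t : ℂ) ≠ 0 := by exact_mod_cast ht.ne'
  refine ⟨(t : ℂ)⁻¹ • Y, t, ⟨?_, ?_⟩, ht.le, ?_⟩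
  · refine hY.smul_of_nonneg ?_
    rw [← Complex.ofReal_inv]
    exact_mod_cast (inv_pos.mpr ht).le
  · rw [tr_smul, ← htY, inv_mul_cancel₀ ht0]
  · have hproj (i : Fin M) :
        projNonpos ((p i : ℂ) • τ i - (t : ℂ) • (t : ℂ)⁻¹ • Y) = 1 := by
      refine projNonpos_eq_one ?_
      rw [smul_inv_smul₀ ht0, neg_sub]
      exact hsub i
    simp only [spectrumObjective, hproj, mul_one, (hτ _).tr_eq_one, Complex.one_re, hp_sum]
    rw [ht_def, re_tr_lagrangeOperator]
    ring

end POVM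

end QuantumHT

theorem corollary1 {H : Type*} [NormedAddCommGroup H] [InnerProductSpace ℂ H]
    [FiniteDimensional ℂ H] (M : ℕ) (p : Fin M → ℝ) (τ : Fin M → H →L[ℂ] H)
    (hp_nonneg : ∀ i, 0 ≤ p i) (hp_sum : ∑ i, p i = 1)
    (hτ : ∀ i, QuantumHT.IsDensityOperator (τ i)) :
    IsLeast (QuantumHT.achievableErrors p τ) (QuantumHT.minErrorProb p τ) ∧
    IsGreatest
      {x : ℝ | ∃ (μ₀ : H →L[ℂ] H) (t : ℝ), QuantumHT.IsDensityOperator μ₀ ∧ 0 ≤ t ∧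
        x = QuantumHT.spectrumObjective p τ μ₀ t}
      (QuantumHT.minErrorProb p τ) := by
  have hM : 0 < M := by
    rcases Nat.eq_zero_or_pos M with rfl | h
    · simp at hp_sum
    · exact h
  obtain ⟨P, hP, hmin⟩ := QuantumHT.exists_isPOVM_forall_errorProb_le hM p τ
  have hleast : IsLeast (QuantumHT.achievableErrors p τ) (QuantumHT.errorProb p τ P) :=
    ⟨⟨P, hP, rfl⟩, by rintro _ ⟨Q, hQ, rfl⟩; exact hmin Q hQ⟩
  have heq : QuantumHT.minErrorProb p τ = QuantumHT.errorProb p τ P := hleast.csInf_eq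
  rw [heq]
  refine ⟨hleast, QuantumHT.exists_spectrumObjective_eq hp_nonneg hp_sum hτ hP hmin, ?_⟩
  rintro _ ⟨μ₀, t, hμ₀, ht, rfl⟩
  exact QuantumHT.spectrumObjective_le_errorProb hp_nonneg hp_sum hτ hμ₀ ht hP
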